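/- For complex $s$ for which the series converge, put $$\zeta_A(s)=\sum_{k=1}^{\infty}\frac{(-1)^{k-1}}{k^s},\qquad \zeta_{A,H}(s)=\sum_{k=1}^{\infty}\frac{(-1)^{k-1}H_k}{k^s},\qquad H_k=1+\frac12+\dots+\frac1k,$$ and let $\zeta$ be the Riemann zeta function. Then for every integer $n\ge 1$ the series defining $\zeta_{A,H}(2n)$ and $\zeta_A(2n-2j)$ for $1\le j\le n-1$ converge absolutely, and $$\zeta_{A,H}(2n)=\Bigl(n-\frac{n}{2^{2n}}-\frac{1}{2^{2n+1}}\Bigr)\zeta(2n+1)-\sum_{j=1}^{n-1}\zeta(2j+1)\,\zeta_A(2n-2j).$$ -/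

import Mathlib

/-- The `k`-th term (`k = 0, 1, 2, …`, so that `k + 1` runs over the positive integers) of the alternating
zeta series: `(-1) ^ k / (k + 1) ^ s`. -/
noncomputable def altZetaTerm (s : ℂ) (k : ℕ) : ℂ :=
  (-1) ^ k / ((k + 1 : ℕ) : ℂ) ^ s

/-- The `k`-th term (`k = 0, 1, 2, …`) of the alternating harmonic zeta series:
`(-1) ^ k * H_{k + 1} / (k + 1) ^ s`, where `H_m = 1 + 1 / 2 + ⋯ + 1 / m`. -/
noncomputable def altHarmonicZetaTerm (s : ℂ) (k : ℕ) : ℂ :=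
  (-1) ^ k * ((harmonic (k + 1) : ℚ) : ℂ) / ((k + 1 : ℕ) : ℂ) ^ s

/-- The alternating zeta function, the sum of its series taken as the limit of partial sums. -/
noncomputable def altZeta (s : ℂ) : ℂ :=
  ∑'[SummationFilter.conditional ℕ] k : ℕ, altZetaTerm s k

/-- The alternating harmonic zeta function, the sum of its series taken as the limit of partial
sums. -/
noncomputable def altHarmonicZeta (s : ℂ) : ℂ :=
  ∑'[SummationFilter.conditional ℕ] k : ℕ, altHarmonicZetaTerm s k

open Filter Topology Finset

/-! Put n = r + 1, K = k + 1, M = m + 1. Written as a double series over (K, M), the sum of products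
ζ_A · ζ has a geometric sum as its term (`sum_pow_mul_pow_eq`). The diagonal gives r ζ_A(2r+3). Off
it remain (-1)^k / M^(2r+1) and (-1)^k / (K^(2r) M), each times the kernel 1 / (K² - M²). Both
double series converge absolutely (`summable_inv_mul_abs_invSqDiff`), so the first may be summed
over K first and the second over M first. Partial fractions make these inner sums telescope
(`hasSum_alternating_mul_invSqDiff`, `hasSum_inv_mul_invSqDiff`); the second produces H_K. Finally
ζ_A(s) = (1 - 2^(1-s)) ζ(s). -/

/-! ### Telescoping limits -/

lemma tendsto_sum_shift_sub (t : ℤ → ℝ) (ht : Tendsto t atTop (𝓝 0)) (m : ℕ) :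
    Tendsto (fun N : ℕ => ∑ k ∈ range N, (t (k + 1 - m) - t (k + 1 + m))) atTop
      (𝓝 (∑ i ∈ range m, (t (-i) + t (i + 1)))) := by
  have hshift : ∀ a : ℤ, Tendsto (fun N : ℕ => t (N + a)) atTop (𝓝 0) := fun a =>
    ht.comp (tendsto_atTop_add_const_right _ a tendsto_natCast_atTop_atTop)
  induction m with
  | zero => simp
  | succ m ih =>
    -- Widening the shift by one adds two fixed terms and two tail terms that vanish as N grows.
    have key : ∀ N : ℕ, ∑ k ∈ range N, (t (k + 1 - (m + 1 : ℕ)) - t (k + 1 + (m + 1 : ℕ))) =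
        ∑ k ∈ range N, (t (k + 1 - m) - t (k + 1 + m)) +
          (t (-m) + t (m + 1) - t (N + (-m)) - t (N + (m + 1))) := by
      intro N
      induction N with
      | zero => simp [add_comm]
      | succ N ihN =>
        rw [sum_range_succ, ihN, sum_range_succ]
        push_cast
        rw [show (N : ℤ) + 1 - (m + 1) = N + -m by ring,
          show (N : ℤ) + 1 + (m + 1) = N + 1 + (m + 1) by ring,
          show (N : ℤ) + 1 - m = N + 1 + -m by ring,
          show (N : ℤ) + 1 + m = N + (m + 1) by ring]
        ring
    simp_rw [key]
    rw [sum_range_succ]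
    have := ih.add (((tendsto_const_nhds (x := t (-m) + t (m + 1))).sub (hshift (-m))).sub
      (hshift (m + 1)))
    simpa using this

lemma tendsto_sum_shift_symm (t : ℤ → ℝ) (ht : Tendsto t atTop (𝓝 0)) (k : ℕ) :
    Tendsto (fun N : ℕ => ∑ m ∈ range N, (2 * t (m + 1) - t (m + 1 - k) - t (m + 1 + k))) atTop
      (𝓝 (∑ i ∈ range k, (t (i + 1) - t (-i)))) := by
  have hshift : ∀ a : ℤ, Tendsto (fun N : ℕ => t (N + a)) atTop (𝓝 0) := fun a =>
    ht.comp (tendsto_atTop_add_const_right _ a tendsto_natCast_atTop_atTop)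
  induction k with
  | zero =>
    have : ∀ m : ℕ, 2 * t (m + 1) - t (m + 1) - t (m + 1) = 0 := fun m => by ring
    simp [this]
  | succ k ih =>
    have key : ∀ N : ℕ, ∑ m ∈ range N,
          (2 * t (m + 1) - t (m + 1 - (k + 1 : ℕ)) - t (m + 1 + (k + 1 : ℕ))) =
        ∑ m ∈ range N, (2 * t (m + 1) - t (m + 1 - k) - t (m + 1 + k)) +
          (t (k + 1) - t (-k) + t (N + (-k)) - t (N + (k + 1))) := by
      intro N
      induction N with
      | zero => simp
      | succ N ihN =>
        rw [sum_range_succ, ihN, sum_range_succ]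
        push_cast
        rw [show (N : ℤ) + 1 - (k + 1) = N + -k by ring,
          show (N : ℤ) + 1 + (k + 1) = N + 1 + (k + 1) by ring,
          show (N : ℤ) + 1 - k = N + 1 + -k by ring,
          show (N : ℤ) + 1 + k = N + (k + 1) by ring]
        ring
    simp_rw [key]
    rw [sum_range_succ]
    have := ih.add (((tendsto_const_nhds (x := t (k + 1) - t (-k))).add (hshift (-k))).sub
      (hshift (k + 1)))
    simpa using this

lemma tendsto_intCast_inv_atTop : Tendsto (fun l : ℤ => (l : ℝ)⁻¹) atTop (𝓝 0) :=
  tendsto_inv_atTop_zero.comp tendsto_intCast_atTop_atTop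

lemma tendsto_alternating_inv_atTop :
    Tendsto (fun l : ℤ => (-1 : ℝ) ^ l * (l : ℝ)⁻¹) atTop (𝓝 0) := by
  rw [tendsto_zero_iff_norm_tendsto_zero]
  simpa [norm_zpow] using tendsto_intCast_inv_atTop.norm

/-! ### The kernel and its absolute convergence -/

/-- The inverse difference of squares `1 / ((k + 1)² - (m + 1)²)`, which is `0` if `k = m`. -/
noncomputable def invSqDiff (k m : ℕ) : ℝ := (((k : ℝ) + 1) ^ 2 - ((m : ℝ) + 1) ^ 2)⁻¹

lemma invSqDiff_self (k : ℕ) : invSqDiff k k = 0 := by simp [invSqDiff]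

/-- With D = |K - M|, both M and D are at most K + M, so √(MD) ≤ K + M. The bound splits into
functions of M and of K - M, each summable. -/
lemma inv_mul_abs_invSqDiff_le (k m : ℕ) :
    ((m : ℝ) + 1)⁻¹ * |invSqDiff k m| ≤
      ((m : ℝ) + 1) ^ (-(3 / 2) : ℝ) * |(((k : ℤ) - m : ℤ) : ℝ)| ^ (-(3 / 2) : ℝ) := by
  rcases eq_or_ne k m with rfl | hkm
  · rw [invSqDiff_self]
    simp only [abs_zero, mul_zero]
    positivity
  have hM : (0 : ℝ) < (m : ℝ) + 1 := by positivity
  have hK : (0 : ℝ) < (k : ℝ) + 1 := by positivity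
  have hd : ((k : ℝ) - m) ≠ 0 := sub_ne_zero.mpr (by exact_mod_cast hkm)
  have hD : 0 < |(k : ℝ) - m| := abs_pos.mpr hd
  have hDS : |(k : ℝ) - m| ≤ (k + 1) + (m + 1) := by
    rw [abs_le]; constructor <;> linarith
  push_cast
  set M : ℝ := (m : ℝ) + 1
  set D : ℝ := |(k : ℝ) - m|
  have hinv : |invSqDiff k m| = (D * ((k + 1) + M))⁻¹ := by
    rw [invSqDiff, abs_inv, show ((k : ℝ) + 1) ^ 2 - ((m : ℝ) + 1) ^ 2
      = (k - m) * ((k + 1) + M) by simp only [M]; ring, abs_mul,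
      abs_of_pos (a := (k : ℝ) + 1 + M) (by positivity)]
  rw [hinv, ← Real.mul_rpow hM.le hD.le, ← mul_inv, Real.rpow_neg (by positivity)]
  apply inv_anti₀ (by positivity)
  rw [show (3 / 2 : ℝ) = 1 + 1 / 2 by norm_num, Real.rpow_add (by positivity), Real.rpow_one,
    ← Real.sqrt_eq_rpow, ← mul_assoc M D]
  have : √(M * D) ≤ (k + 1) + M := by
    apply Real.sqrt_le_iff.mpr
    refine ⟨by positivity, ?_⟩
    rw [sq]
    exact mul_le_mul (by linarith) hDS hD.le (by positivity)
  gcongr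

lemma summable_inv_mul_abs_invSqDiff :
    Summable fun p : ℕ × ℕ => ((p.2 : ℝ) + 1)⁻¹ * |invSqDiff p.1 p.2| := by
  have h1 : Summable fun m : ℕ => ((m : ℝ) + 1) ^ (-(3 / 2) : ℝ) := by
    have h := (summable_nat_add_iff 1).mpr
      (Real.summable_nat_rpow (p := -(3 / 2)) |>.mpr (by norm_num))
    exact h.congr fun m => by push_cast; rfl
  have h2 : Summable fun l : ℤ => |(l : ℝ)| ^ (-(3 / 2) : ℝ) :=
    Real.summable_abs_int_rpow (by norm_num)
  have h3 := h1.mul_of_nonneg h2 (fun m => by positivity) (fun l => by positivity)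
  have hinj : Function.Injective fun p : ℕ × ℕ => (p.2, (p.1 : ℤ) - p.2) := by
    rintro ⟨a, b⟩ ⟨c, d⟩ h
    simp only [Prod.mk.injEq] at h ⊢
    omega
  have h4 := h3.comp_injective hinj
  simp only [Function.comp_def] at h4
  exact Summable.of_nonneg_of_le (fun p => mul_nonneg (by positivity) (abs_nonneg _))
    (fun p => inv_mul_abs_invSqDiff_le p.1 p.2) h4

lemma summable_mul_invSqDiff_of_abs_le {c : ℕ × ℕ → ℝ} (hc : ∀ p, |c p| ≤ ((p.2 : ℝ) + 1)⁻¹) :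
    Summable fun p : ℕ × ℕ => c p * invSqDiff p.1 p.2 := by
  refine Summable.of_norm_bounded summable_inv_mul_abs_invSqDiff fun p => ?_
  rw [Real.norm_eq_abs, abs_mul]
  gcongr
  exact hc p

lemma summable_alternating_mul_invSqDiff (m : ℕ) :
    Summable fun k : ℕ => (-1) ^ k * invSqDiff k m := by
  have h := (summable_inv_mul_abs_invSqDiff.comp_injective
    (i := fun k : ℕ => (k, m)) (fun a b h => by simpa using h)).mul_left ((m : ℝ) + 1)
  refine Summable.of_norm (h.congr fun k => ?_)
  have : (m : ℝ) + 1 ≠ 0 := by positivity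
  simp [this]

/-! ### Inner sums of the kernel -/

/-- Partial fractions: 2M / (K² - M²) = 1 / (K - M) - 1 / (K + M), and (-1)^(K-M) = (-1)^(K+M). -/
lemma hasSum_alternating_mul_invSqDiff (m : ℕ) :
    HasSum (fun k : ℕ => (-1) ^ k * invSqDiff k m)
      (-(1 / 2) / ((m : ℝ) + 1) ^ 2 + (-1) ^ m / 4 / ((m : ℝ) + 1) ^ 2) := by
  set t : ℤ → ℝ := fun l => (-1 : ℝ) ^ l * (l : ℝ)⁻¹ with htdef
  have hodd : ∀ l, t (-l) = - t l := fun l => by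
    rcases Int.even_or_odd l with h | h <;> simp [htdef, h.neg_one_zpow]
  have hM : (m : ℝ) + 1 ≠ 0 := by positivity
  have hlim := tendsto_sum_shift_sub t tendsto_alternating_inv_atTop (m + 1)
  have hval : ∑ i ∈ range (m + 1), (t (-i) + t (i + 1)) = -((-1) ^ m / ((m : ℝ) + 1)) := by
    have : ∀ i : ℕ, t (-i) + t (i + 1) = t ((i + 1 : ℕ) : ℤ) - t (i : ℤ) := fun i => by
      rw [hodd]; push_cast; ring
    simp_rw [this]
    rw [sum_range_sub (fun i : ℕ => t (i : ℤ))]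
    simp only [htdef, zpow_natCast, Int.cast_natCast, Nat.cast_zero, Int.cast_zero, inv_zero,
      mul_zero, sub_zero, pow_succ]
    push_cast
    field_simp
  -- At K = M the kernel is 0, while t(0) - t(2M) = -1 / (2M), since 0⁻¹ = 0.
  have hdiag : HasSum (fun k : ℕ => if k = m then -(1 / (2 * ((m : ℝ) + 1))) else 0)
      (-(1 / (2 * ((m : ℝ) + 1)))) := hasSum_ite_eq m _
  have hterm : ∀ k : ℕ, (t (k + 1 - (m + 1 : ℕ)) - t (k + 1 + (m + 1 : ℕ))) =
      (-1) ^ m * (2 * (m + 1)) * ((-1) ^ k * invSqDiff k m) +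
        if k = m then -(1 / (2 * ((m : ℝ) + 1))) else 0 := by
    intro k
    have e1 : (-1 : ℝ) ^ ((k : ℤ) + 1 - (m + 1 : ℕ)) = (-1) ^ m * (-1) ^ k := by
      rw [show (k : ℤ) + 1 - (m + 1 : ℕ) = k - m by push_cast; ring, zpow_sub₀ (by norm_num),
        zpow_natCast, zpow_natCast, div_eq_iff (by simp), mul_right_comm, ← mul_pow]
      simp
    have e2 : (-1 : ℝ) ^ ((k : ℤ) + 1 + (m + 1 : ℕ)) = (-1) ^ m * (-1) ^ k := by
      rw [show (k : ℤ) + 1 + (m + 1 : ℕ) = ((m + k + 2 : ℕ) : ℤ) by push_cast; ring,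
        zpow_natCast]
      ring
    simp only [htdef, e1, e2]
    split_ifs with h
    · subst h
      rw [invSqDiff_self, ← mul_pow]
      push_cast
      norm_num
      rw [← two_mul]
      simp
    · have hd : ((k : ℝ) - m) ≠ 0 := sub_ne_zero.mpr (by exact_mod_cast h)
      have hs : ((k : ℝ) + 1 + (m + 1)) ≠ 0 := by positivity
      rw [invSqDiff, show ((k : ℝ) + 1) ^ 2 - ((m : ℝ) + 1) ^ 2
        = (k - m) * ((k + 1) + (m + 1)) by ring]
      push_cast
      rw [show (k : ℝ) + 1 - (m + 1) = k - m by ring]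
      field_simp
      ring
  have hS := ((summable_alternating_mul_invSqDiff m).hasSum.mul_left
    ((-1) ^ m * (2 * ((m : ℝ) + 1)))).add hdiag
  have heq := tendsto_nhds_unique hS.tendsto_sum_nat
    (by simpa only [hterm, hval] using hlim)
  have hsq : ((-1 : ℝ) ^ m) * (-1) ^ m = 1 := by rw [← mul_pow]; simp
  convert (summable_alternating_mul_invSqDiff m).hasSum using 1
  set X := ∑' k : ℕ, (-1) ^ k * invSqDiff k m
  have h2 : (2 * ((m : ℝ) + 1)) * X = (-1) ^ m * (-((-1) ^ m / ((m : ℝ) + 1)) +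
      1 / (2 * ((m : ℝ) + 1))) := by
    linear_combination ((-1) ^ m) * heq - (2 * ((m : ℝ) + 1)) * X * hsq
  have h3 : X = (-1) ^ m * (-((-1) ^ m / ((m : ℝ) + 1)) +
      1 / (2 * ((m : ℝ) + 1))) / (2 * ((m : ℝ) + 1)) := by
    rw [← h2]; field_simp
  rw [h3]
  field_simp
  linear_combination 8 * hsq

lemma summable_inv_mul_invSqDiff (k : ℕ) :
    Summable fun m : ℕ => ((m : ℝ) + 1)⁻¹ * invSqDiff k m :=
  Summable.of_norm <| (summable_inv_mul_abs_invSqDiff.comp_injective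
    (i := fun m : ℕ => (k, m)) (fun a b h => by simpa using h)).congr fun m => by
      have : |(m : ℝ) + 1| = m + 1 := abs_of_pos (by positivity)
      simp [this]

/-- Partial fractions: 2K² / (M (K² - M²)) = 2/M - 1/(M - K) - 1/(M + K). The telescoped limit is
H_K + H_{K-1} = 2 H_K - 1/K; removing the diagonal excess 3/(2K) gives the 5/4. -/
lemma hasSum_inv_mul_invSqDiff (k : ℕ) :
    HasSum (fun m : ℕ => ((m : ℝ) + 1)⁻¹ * invSqDiff k m)
      (((harmonic (k + 1) : ℚ) - 5 / 4 / ((k : ℝ) + 1)) / ((k : ℝ) + 1) ^ 2) := by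
  set t : ℤ → ℝ := fun l => (l : ℝ)⁻¹ with htdef
  have hK : (k : ℝ) + 1 ≠ 0 := by positivity
  have hlim := tendsto_sum_shift_symm t tendsto_intCast_inv_atTop (k + 1)
  have hval : ∀ n : ℕ, ∑ i ∈ range (n + 1), (t (i + 1) - t (-i)) =
      2 * (harmonic (n + 1) : ℚ) - 1 / ((n : ℝ) + 1) := by
    intro n
    induction n with
    | zero => simp [htdef]; norm_num
    | succ n ih =>
      rw [sum_range_succ, ih, harmonic_succ (n + 1)]
      simp only [htdef]
      push_cast
      rw [inv_neg]
      ring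
  have hdiag : HasSum (fun m : ℕ => if m = k then 3 / (2 * ((k : ℝ) + 1)) else 0)
      (3 / (2 * ((k : ℝ) + 1))) := hasSum_ite_eq k _
  have hterm : ∀ m : ℕ, 2 * t (m + 1) - t (m + 1 - (k + 1 : ℕ)) - t (m + 1 + (k + 1 : ℕ)) =
      2 * (k + 1) ^ 2 * (((m : ℝ) + 1)⁻¹ * invSqDiff k m) +
        if m = k then 3 / (2 * ((k : ℝ) + 1)) else 0 := by
    intro m
    have hM : (m : ℝ) + 1 ≠ 0 := by positivity
    simp only [htdef]
    split_ifs with h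
    · subst h
      rw [invSqDiff_self]
      push_cast
      rw [sub_self, ← two_mul]
      field_simp
      norm_num
    · have hd : ((m : ℝ) - k) ≠ 0 := sub_ne_zero.mpr (by exact_mod_cast h)
      have hs : ((m : ℝ) + 1 + (k + 1)) ≠ 0 := by positivity
      rw [invSqDiff, show ((k : ℝ) + 1) ^ 2 - ((m : ℝ) + 1) ^ 2
        = -((m - k) * ((m + 1) + (k + 1))) by ring]
      push_cast
      rw [show (m : ℝ) + 1 - (k + 1) = m - k by ring, inv_neg]
      field_simp
      ring
  have hS := ((summable_inv_mul_invSqDiff k).hasSum.mul_left (2 * ((k : ℝ) + 1) ^ 2)).add hdiag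
  have heq := tendsto_nhds_unique hS.tendsto_sum_nat
    (by simpa only [hterm, hval] using hlim)
  convert (summable_inv_mul_invSqDiff k).hasSum using 1
  rw [div_eq_iff (by positivity)]
  have : (harmonic (k + 1) : ℝ) = (2 * ((k : ℝ) + 1) ^ 2 *
    (∑' m : ℕ, ((m : ℝ) + 1)⁻¹ * invSqDiff k m) + 3 / (2 * ((k : ℝ) + 1)) + 1 / (k + 1)) / 2 := by
    rw [heq]; ring
  rw [this]
  field_simp
  ring

/-! ### The series for ζ and ζ_A -/

lemma summable_one_div_succ_pow (r : ℕ) : Summable fun k : ℕ => 1 / ((k : ℝ) + 1) ^ (r + 2) := by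
  have h := (summable_nat_add_iff 1).mpr
    (Real.summable_one_div_nat_pow (p := r + 2) |>.mpr (by omega))
  exact h.congr fun k => by push_cast; rfl

lemma summable_alternating_div_succ_pow (r : ℕ) :
    Summable fun k : ℕ => (-1 : ℝ) ^ k / ((k : ℝ) + 1) ^ (r + 2) :=
  (summable_one_div_succ_pow r).of_norm_bounded fun k => by
    have : |(k : ℝ) + 1| = k + 1 := abs_of_pos (by positivity)
    simp [this]

lemma tsum_alternating_div_succ_pow (r : ℕ) :
    ∑' k : ℕ, (-1 : ℝ) ^ k / ((k : ℝ) + 1) ^ (r + 2) =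
      (1 - 2 / 2 ^ (r + 2)) * ∑' k : ℕ, 1 / ((k : ℝ) + 1) ^ (r + 2) := by
  have hz := summable_one_div_succ_pow r
  have ha := summable_alternating_div_succ_pow r
  have heven : Function.Injective fun k : ℕ => 2 * k := fun a b h => by simpa using h
  have hodd : Function.Injective fun k : ℕ => 2 * k + 1 := fun a b h => by simpa using h
  have hz₀ := hz.comp_injective heven
  have hz₁ := hz.comp_injective hodd
  have ha₀ := ha.comp_injective heven
  have ha₁ := ha.comp_injective hodd
  simp only [Function.comp_def] at hz₀ hz₁ ha₀ ha₁
  have hz' := tsum_even_add_odd (f := fun k : ℕ => 1 / ((k : ℝ) + 1) ^ (r + 2)) hz₀ hz₁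
  have ha' := tsum_even_add_odd (f := fun k : ℕ => (-1 : ℝ) ^ k / ((k : ℝ) + 1) ^ (r + 2)) ha₀ ha₁
  have h1 : ∀ k : ℕ, (-1 : ℝ) ^ (2 * k) / (((2 * k : ℕ) : ℝ) + 1) ^ (r + 2) =
      1 / (((2 * k : ℕ) : ℝ) + 1) ^ (r + 2) := fun k => by simp [pow_mul]
  have h2 : ∀ k : ℕ, (-1 : ℝ) ^ (2 * k + 1) / (((2 * k + 1 : ℕ) : ℝ) + 1) ^ (r + 2) =
      -(1 / 2 ^ (r + 2) * (1 / ((k : ℝ) + 1) ^ (r + 2))) := fun k => by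
    push_cast
    rw [show (2 * (k : ℝ) + 1 + 1) = 2 * (k + 1) by ring, mul_pow, pow_succ, pow_mul]
    field_simp
    norm_num
  have h3 : ∀ k : ℕ, 1 / (((2 * k + 1 : ℕ) : ℝ) + 1) ^ (r + 2) =
      1 / 2 ^ (r + 2) * (1 / ((k : ℝ) + 1) ^ (r + 2)) := fun k => by
    push_cast
    rw [show (2 * (k : ℝ) + 1 + 1) = 2 * (k + 1) by ring, mul_pow]
    field_simp
  simp_rw [h1, h2, tsum_neg, tsum_mul_left] at ha'
  simp_rw [h3, tsum_mul_left] at hz'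
  rw [← ha']
  linear_combination hz'

/-! ### The double series -/

/-- A geometric sum in `1 / (m + 1)²` and `1 / (k + 1)²`, off the diagonal and on it. -/
lemma sum_pow_mul_pow_eq (r k m : ℕ) :
    ∑ i ∈ range r, (-1 : ℝ) ^ k / ((k : ℝ) + 1) ^ (2 * (r - 1 - i) + 2) *
        (1 / ((m : ℝ) + 1) ^ (2 * i + 1 + 2)) =
      (if m = k then r * ((-1 : ℝ) ^ k / ((k : ℝ) + 1) ^ (2 * r + 1 + 2)) else 0) +
        ((-1) ^ k * (1 / ((m : ℝ) + 1) ^ (2 * r + 1)) * invSqDiff k m -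
          (-1) ^ k / ((k : ℝ) + 1) ^ (2 * r) * ((m : ℝ) + 1)⁻¹ * invSqDiff k m) := by
  have hK : (k : ℝ) + 1 ≠ 0 := by positivity
  have hM : (m : ℝ) + 1 ≠ 0 := by positivity
  split_ifs with h
  · subst h
    rw [invSqDiff_self, mul_zero, mul_zero, sub_zero, add_zero, ← card_range r, ← nsmul_eq_mul,
      ← sum_const, card_range]
    refine sum_congr rfl fun i hi => ?_
    have hi := mem_range.mp hi
    rw [div_mul_div_comm, ← pow_add, mul_one]
    congr 2
    omega
  · have hd : ((k : ℝ) - m) ≠ 0 := sub_ne_zero.mpr (by exact_mod_cast (Ne.symm h))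
    have hs : ((k : ℝ) + 1 + (m + 1)) ≠ 0 := by positivity
    have hg := geom_sum₂_mul (((m : ℝ) + 1)⁻¹ ^ 2) (((k : ℝ) + 1)⁻¹ ^ 2) r
    have hsum : ∑ i ∈ range r, (-1 : ℝ) ^ k / ((k : ℝ) + 1) ^ (2 * (r - 1 - i) + 2) *
        (1 / ((m : ℝ) + 1) ^ (2 * i + 1 + 2)) =
        (-1) ^ k / (((k : ℝ) + 1) ^ 2 * ((m : ℝ) + 1) ^ 3) *
        ∑ i ∈ range r, (((m : ℝ) + 1)⁻¹ ^ 2) ^ i * (((k : ℝ) + 1)⁻¹ ^ 2) ^ (r - 1 - i) := by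
      rw [mul_sum]
      refine sum_congr rfl fun i _ => ?_
      simp only [← pow_mul, inv_pow, pow_add]
      field_simp
    have hxy : ((m : ℝ) + 1)⁻¹ ^ 2 - ((k : ℝ) + 1)⁻¹ ^ 2 =
        (k - m) * (k + 1 + (m + 1)) / (((k : ℝ) + 1) ^ 2 * ((m : ℝ) + 1) ^ 2) := by
      field_simp
      ring
    rw [hxy] at hg
    rw [hsum, zero_add, invSqDiff, show ((k : ℝ) + 1) ^ 2 - ((m : ℝ) + 1) ^ 2
        = (k - m) * ((k + 1) + (m + 1)) by ring]
    set S := ∑ i ∈ range r, (((m : ℝ) + 1)⁻¹ ^ 2) ^ i * (((k : ℝ) + 1)⁻¹ ^ 2) ^ (r - 1 - i)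
    have hS : S = ((((m : ℝ) + 1)⁻¹ ^ 2) ^ r - (((k : ℝ) + 1)⁻¹ ^ 2) ^ r) *
        (((k : ℝ) + 1) ^ 2 * ((m : ℝ) + 1) ^ 2) / ((k - m) * (k + 1 + (m + 1))) := by
      rw [← hg]; field_simp
    have hpow : ∀ x : ℝ, (x⁻¹ ^ 2) ^ r = (x ^ (2 * r))⁻¹ := fun x => by rw [← pow_mul, inv_pow]
    rw [hS, hpow, hpow]
    field_simp
    ring

lemma hasSum_alternating_div_pow_mul_inv_mul_invSqDiff (r : ℕ) :
    Summable (fun k : ℕ => (-1 : ℝ) ^ k * (harmonic (k + 1) : ℚ) / ((k : ℝ) + 1) ^ (2 * r + 2)) ∧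
    HasSum (fun p : ℕ × ℕ =>
        (-1 : ℝ) ^ p.1 / ((p.1 : ℝ) + 1) ^ (2 * r) * ((p.2 : ℝ) + 1)⁻¹ * invSqDiff p.1 p.2)
      (∑' k : ℕ, (-1 : ℝ) ^ k * (harmonic (k + 1) : ℚ) / ((k : ℝ) + 1) ^ (2 * r + 2) -
        5 / 4 * ∑' k : ℕ, (-1 : ℝ) ^ k / ((k : ℝ) + 1) ^ (2 * r + 1 + 2)) := by
  have hs : Summable fun p : ℕ × ℕ =>
      (-1 : ℝ) ^ p.1 / ((p.1 : ℝ) + 1) ^ (2 * r) * ((p.2 : ℝ) + 1)⁻¹ * invSqDiff p.1 p.2 := by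
    refine summable_mul_invSqDiff_of_abs_le fun p => ?_
    have h1 : |(p.1 : ℝ) + 1| = p.1 + 1 := abs_of_pos (by positivity)
    have h2 : |(p.2 : ℝ) + 1| = p.2 + 1 := abs_of_pos (by positivity)
    rw [abs_mul, abs_div, abs_pow, abs_pow, abs_inv, abs_neg, abs_one, one_pow, h1, h2]
    refine mul_le_of_le_one_left (by positivity) ?_
    rw [div_le_one (by positivity)]
    exact one_le_pow₀ (by simp)
  have hfib : HasSum (fun k : ℕ => (-1 : ℝ) ^ k / ((k : ℝ) + 1) ^ (2 * r) *
      (((harmonic (k + 1) : ℚ) - 5 / 4 / ((k : ℝ) + 1)) / ((k : ℝ) + 1) ^ 2)) _ :=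
    hs.hasSum.prod_fiberwise fun k => by
      simpa only [mul_assoc] using (hasSum_inv_mul_invSqDiff k).mul_left _
  have heta := (summable_alternating_div_succ_pow (2 * r + 1)).hasSum.mul_left (5 / 4)
  have hH := hfib.add heta
  have hterm : (fun k : ℕ => (-1 : ℝ) ^ k / ((k : ℝ) + 1) ^ (2 * r) *
      (((harmonic (k + 1) : ℚ) - 5 / 4 / ((k : ℝ) + 1)) / ((k : ℝ) + 1) ^ 2) +
      5 / 4 * ((-1 : ℝ) ^ k / ((k : ℝ) + 1) ^ (2 * r + 1 + 2))) =
      fun k : ℕ => (-1 : ℝ) ^ k * (harmonic (k + 1) : ℚ) / ((k : ℝ) + 1) ^ (2 * r + 2) := by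
    ext k
    have hK : (k : ℝ) + 1 ≠ 0 := by positivity
    simp only [pow_succ]
    field_simp
    ring
  rw [hterm] at hH
  -- Convergence of the harmonic series comes with the fibrewise summation, without a bound on H_K.
  refine ⟨hH.summable, ?_⟩
  rw [hH.tsum_eq, add_sub_cancel_right]
  exact hs.hasSum

lemma hasSum_alternating_mul_inv_pow_mul_invSqDiff (r : ℕ) :
    HasSum (fun p : ℕ × ℕ => (-1 : ℝ) ^ p.1 * (1 / ((p.2 : ℝ) + 1) ^ (2 * r + 1)) *
        invSqDiff p.1 p.2)
      (-(1 / 2) * ∑' k : ℕ, 1 / ((k : ℝ) + 1) ^ (2 * r + 1 + 2) +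
        1 / 4 * ∑' k : ℕ, (-1 : ℝ) ^ k / ((k : ℝ) + 1) ^ (2 * r + 1 + 2)) := by
  have hs : Summable fun p : ℕ × ℕ => (-1 : ℝ) ^ p.1 * (1 / ((p.2 : ℝ) + 1) ^ (2 * r + 1)) *
        invSqDiff p.1 p.2 := by
    refine summable_mul_invSqDiff_of_abs_le fun p => ?_
    have h2 : |(p.2 : ℝ) + 1| = p.2 + 1 := abs_of_pos (by positivity)
    rw [abs_mul, abs_div, abs_pow, abs_pow, abs_neg, abs_one, one_pow, h2, one_mul, one_div]
    refine inv_anti₀ (by positivity) ?_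
    exact le_self_pow₀ (by simp) (by omega)
  have hfib : HasSum (fun m : ℕ => (1 / ((m : ℝ) + 1) ^ (2 * r + 1)) *
      (-(1 / 2) / ((m : ℝ) + 1) ^ 2 + (-1) ^ m / 4 / ((m : ℝ) + 1) ^ 2)) _ :=
    -- The swap puts the alternating index inside.
    ((Equiv.prodComm ℕ ℕ).hasSum_iff.mpr hs.hasSum).prod_fiberwise fun m => by
      refine ((hasSum_alternating_mul_invSqDiff m).mul_left _).congr_fun fun k => ?_
      simp only [Function.comp, Equiv.prodComm_apply, Prod.swap]
      ring
  have h := ((summable_one_div_succ_pow (2 * r + 1)).hasSum.mul_left (-(1 / 2))).add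
    ((summable_alternating_div_succ_pow (2 * r + 1)).hasSum.mul_left (1 / 4))
  have heq := hfib.unique (h.congr_fun fun k => by
    have hK : (k : ℝ) + 1 ≠ 0 := by positivity
    simp only [pow_succ]
    field_simp)
  rw [← heq]
  exact hs.hasSum

lemma hasSum_mul_of_summable {f g : ℕ → ℝ} (hf : Summable f) (hg : Summable g) :
    HasSum (fun p : ℕ × ℕ => f p.1 * g p.2) ((∑' k, f k) * ∑' m, g m) :=
  hf.hasSum.mul hg.hasSum (summable_mul_of_summable_norm hf.norm hg.norm)

lemma sum_tsum_mul_tsum_eq (r : ℕ) :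
    ∑ i ∈ range r, (∑' k : ℕ, (-1 : ℝ) ^ k / ((k : ℝ) + 1) ^ (2 * (r - 1 - i) + 2)) *
        ∑' m : ℕ, 1 / ((m : ℝ) + 1) ^ (2 * i + 1 + 2) =
      (r + 3 / 2) * ∑' k : ℕ, (-1 : ℝ) ^ k / ((k : ℝ) + 1) ^ (2 * r + 1 + 2) -
        1 / 2 * ∑' k : ℕ, 1 / ((k : ℝ) + 1) ^ (2 * r + 1 + 2) -
        ∑' k : ℕ, (-1 : ℝ) ^ k * (harmonic (k + 1) : ℚ) / ((k : ℝ) + 1) ^ (2 * r + 2) := by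
  have hprod : HasSum (fun p : ℕ × ℕ => ∑ i ∈ range r,
      (-1 : ℝ) ^ p.1 / ((p.1 : ℝ) + 1) ^ (2 * (r - 1 - i) + 2) *
        (1 / ((p.2 : ℝ) + 1) ^ (2 * i + 1 + 2)))
      (∑ i ∈ range r, (∑' k : ℕ, (-1 : ℝ) ^ k / ((k : ℝ) + 1) ^ (2 * (r - 1 - i) + 2)) *
        ∑' m : ℕ, 1 / ((m : ℝ) + 1) ^ (2 * i + 1 + 2)) := by
    refine hasSum_sum fun i _ => ?_
    have ha := summable_alternating_div_succ_pow (2 * (r - 1 - i))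
    have hz := summable_one_div_succ_pow (2 * i + 1)
    have h := hasSum_mul_of_summable ha hz
    exact h
  have hUV := (hasSum_alternating_mul_inv_pow_mul_invSqDiff r).sub
    (hasSum_alternating_div_pow_mul_inv_mul_invSqDiff r).2
  -- Subtracting the off-diagonal series leaves one term per row.
  have hdiag := hprod.sub hUV
  simp only [sum_pow_mul_pow_eq, add_sub_cancel_right] at hdiag
  have hfib := hdiag.prod_fiberwise
    (g := fun k : ℕ => r * ((-1 : ℝ) ^ k / ((k : ℝ) + 1) ^ (2 * r + 1 + 2)))
    fun k => hasSum_ite_eq k _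
  have h := hfib.unique
    ((summable_alternating_div_succ_pow (2 * r + 1)).hasSum.mul_left (r : ℝ))
  linear_combination h

/-! ### Transfer to the complex functions -/

lemma altZetaTerm_natCast (s k : ℕ) :
    altZetaTerm (s : ℂ) k = (((-1 : ℝ) ^ k / ((k : ℝ) + 1) ^ s : ℝ) : ℂ) := by
  simp [altZetaTerm]

lemma altHarmonicZetaTerm_natCast (s k : ℕ) :
    altHarmonicZetaTerm (s : ℂ) k =
      (((-1 : ℝ) ^ k * (harmonic (k + 1) : ℚ) / ((k : ℝ) + 1) ^ s : ℝ) : ℂ) := by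
  simp [altHarmonicZetaTerm]

lemma summable_altZetaTerm (r : ℕ) : Summable (altZetaTerm ((r + 2 : ℕ) : ℂ)) :=
  (Complex.hasSum_ofReal.mpr (summable_alternating_div_succ_pow r).hasSum).summable.congr
    fun k => (altZetaTerm_natCast _ k).symm

lemma altZeta_natCast (r : ℕ) :
    altZeta ((r + 2 : ℕ) : ℂ) = ((∑' k : ℕ, (-1 : ℝ) ^ k / ((k : ℝ) + 1) ^ (r + 2) : ℝ) : ℂ) := by
  rw [altZeta, tsum_eq_of_summable_unconditional (summable_altZetaTerm r), Complex.ofReal_tsum]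
  exact tsum_congr fun k => altZetaTerm_natCast _ k

lemma summable_altHarmonicZetaTerm (r : ℕ) :
    Summable (altHarmonicZetaTerm ((2 * r + 2 : ℕ) : ℂ)) :=
  (Complex.hasSum_ofReal.mpr
    (hasSum_alternating_div_pow_mul_inv_mul_invSqDiff r).1.hasSum).summable.congr
    fun k => (altHarmonicZetaTerm_natCast _ k).symm

lemma altHarmonicZeta_natCast (r : ℕ) :
    altHarmonicZeta ((2 * r + 2 : ℕ) : ℂ) = ((∑' k : ℕ, (-1 : ℝ) ^ k * (harmonic (k + 1) : ℚ) /
      ((k : ℝ) + 1) ^ (2 * r + 2) : ℝ) : ℂ) := by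
  rw [altHarmonicZeta, tsum_eq_of_summable_unconditional (summable_altHarmonicZetaTerm r),
    Complex.ofReal_tsum]
  exact tsum_congr fun k => altHarmonicZetaTerm_natCast _ k

lemma riemannZeta_natCast_add_two (r : ℕ) :
    riemannZeta ((r + 2 : ℕ) : ℂ) = ((∑' k : ℕ, 1 / ((k : ℝ) + 1) ^ (r + 2) : ℝ) : ℂ) := by
  rw [zeta_nat_eq_tsum_of_gt_one (by omega), Complex.ofReal_tsum, Summable.tsum_eq_zero_add]
  · simp
  · refine (Complex.hasSum_ofReal.mpr (Real.summable_one_div_nat_pow (p := r + 2) |>.mpr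
      (by omega)).hasSum).summable.congr fun k => ?_
    push_cast
    rfl

theorem mainTheorem8 (n : ℕ) (hn : 1 ≤ n) :
    Summable (altHarmonicZetaTerm (2 * (n : ℂ))) ∧
    (∀ j ∈ Finset.Ico 1 n, Summable (altZetaTerm (2 * (n : ℂ) - 2 * (j : ℂ)))) ∧
    altHarmonicZeta (2 * (n : ℂ)) =
      ((n : ℂ) - (n : ℂ) / 2 ^ (2 * n) - 1 / 2 ^ (2 * n + 1)) * riemannZeta (2 * (n : ℂ) + 1)
        - ∑ j ∈ Finset.Ico 1 n,
            riemannZeta (2 * (j : ℂ) + 1) * altZeta (2 * (n : ℂ) - 2 * (j : ℂ)) := by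
  obtain ⟨r, rfl⟩ := Nat.exists_eq_add_of_le' hn
  have hcast : ∀ i < r, 2 * ((r + 1 : ℕ) : ℂ) - 2 * ((i + 1 : ℕ) : ℂ) =
      ((2 * (r - 1 - i) + 2 : ℕ) : ℂ) := by
    intro i hi
    obtain ⟨d, rfl⟩ := Nat.exists_eq_add_of_lt hi
    rw [show i + d + 1 - 1 - i = d by omega]
    push_cast
    ring
  have h2n : 2 * ((r + 1 : ℕ) : ℂ) = ((2 * r + 2 : ℕ) : ℂ) := by push_cast; ring
  refine ⟨?_, ?_, ?_⟩
  · rw [h2n]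
    exact summable_altHarmonicZetaTerm r
  · intro j hj
    rw [mem_Ico] at hj
    obtain ⟨i, rfl⟩ := Nat.exists_eq_add_of_le' hj.1
    rw [hcast i (by omega)]
    exact summable_altZetaTerm _
  · have hsum : ∑ j ∈ Ico 1 (r + 1), riemannZeta (2 * (j : ℂ) + 1) *
          altZeta (2 * ((r + 1 : ℕ) : ℂ) - 2 * (j : ℂ)) =
        ((∑ i ∈ range r, (∑' k : ℕ, (-1 : ℝ) ^ k / ((k : ℝ) + 1) ^ (2 * (r - 1 - i) + 2)) *
          ∑' m : ℕ, 1 / ((m : ℝ) + 1) ^ (2 * i + 1 + 2) : ℝ) : ℂ) := by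
      rw [sum_Ico_eq_sum_range, Complex.ofReal_sum]
      refine sum_congr rfl fun i hi => ?_
      rw [add_comm 1 i, hcast i (mem_range.mp hi), altZeta_natCast,
        show 2 * ((i + 1 : ℕ) : ℂ) + 1 = ((2 * i + 1 + 2 : ℕ) : ℂ) by push_cast; ring,
        riemannZeta_natCast_add_two, Complex.ofReal_mul, mul_comm]
    rw [hsum, sum_tsum_mul_tsum_eq, tsum_alternating_div_succ_pow,
      show 2 * ((r + 1 : ℕ) : ℂ) + 1 = ((2 * r + 1 + 2 : ℕ) : ℂ) by push_cast; ring,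
      riemannZeta_natCast_add_two, h2n, altHarmonicZeta_natCast]
    push_cast
    simp only [mul_add, pow_add, pow_mul]
    field_simp
    ring
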